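/- Let $G$ be a real Lie group with Lie algebra $\mathfrak g$, and let $s\in S^2\mathfrak g$ be ad-invariant and non-degenerate. Let $s^\sharp:\mathfrak g^*\to\mathfrak g$ be given by $\beta(s^\sharp\alpha)=s(\alpha,\beta)$, identify $\mathfrak g^*$ with $\mathfrak g$ through $s^\sharp$, and let $\phi\in\wedge^3\mathfrak g$ be $\phi(\alpha,\beta,\gamma)=\tfrac12\alpha([s^\sharp\beta,s^\sharp\gamma])$. Let $M$ be a smooth manifold with an action $\rho:\mathfrak g\to\Gamma(TM)$ (a morphism of Lie algebras to the smooth vector fields) and a smooth bivector field $\pi\in\Gamma(\wedge^2TM)$, and write $\beta(\pi^\sharp\alpha)=\pi(\alpha,\beta)$. The triple $(M,\rho,\pi)$ is a quasi-Poisson $\mathfrak g$-manifold if $[\pi,\pi]=\rho(\phi)$ and $[\pi,\rho(\xi)]=0$ for all $\xi\in\mathfrak g$ (Schouten brackets); it is quasi-symplectic if moreover the map $\mathbf a=\pi^\sharp+\tfrac12\,\rho\circ\rho^*:T^*M\to TM$ is bijective. A smooth map $\Phi:M\to G$ is a moment map if it is $\mathfrak g$-equivariant, where $\xi\in\mathfrak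 g$ acts on $G$ by the vector field $\xi^L-\xi^R$ ($\xi^L,\xi^R$ being the left- and right-invariant vector fields of $\xi$), and if $\pi^\sharp(\Phi^*\alpha)=\rho(\Phi^*(b^*\alpha))$ for all $\alpha\in\Omega^1(G)$, where $b_g(\xi)=\tfrac12(\xi^L(g)+\xi^R(g))$. A quasi-Poisson (quasi-symplectic) $\mathfrak g$-manifold together with a moment map is called a Hamiltonian quasi-Poisson (Hamiltonian quasi-symplectic) $\mathfrak g$-manifold. A Hamiltonian quasi-Poisson $\mathfrak g$-manifold is called quasi-Hamiltonian if $\rho_x(\mathfrak g)+\pi_x^\sharp(T_x^*M)=T_xM$ for every $x\in M$. **Theorem.** If $(M,\rho,\pi,\Phi)$ is a Hamiltonian quasi-Poisson $\mathfrak g$-manifold, then for every $x\in M$ $$\rho_x(\mathfrak g)+\pi_x^\sharp(T_x^*M)=\mathbf a_x(T_x^*M).$$ Consequently $(M,\rho,\pi,\Phi)$ is a quasi-Hamiltonian $\mathfrak g$-manifold if and only if it is a Hamiltonian quasi-symplectic $\mathfrak g$-manifold. -/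

import Mathlib

open scoped Manifold ContDiff

noncomputable section

namespace QuasiPoisson

/-! ### Tangent and cotangent spaces -/

instance instFiniteDimensionalTangentSpace {E : Type*} [NormedAddCommGroup E] [NormedSpace ℝ E]
    [FiniteDimensional ℝ E] {M : Type*} [TopologicalSpace M] [ChartedSpace E M] (x : M) :
    FiniteDimensional ℝ (TangentSpace 𝓘(ℝ, E) x) :=
  inferInstanceAs (FiniteDimensional ℝ E)

/-- A smooth Lie group is regular enough for Mathlib's Lie algebra structure on its tangent space
at the identity. -/
instance instLEInftyMinSmoothness : ENat.LEInfty (minSmoothness ℝ 3) :=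
  ⟨by rw [minSmoothness_of_isRCLikeNormedField]; exact ENat.LEInfty.out⟩

/-- The cotangent space `T*_x M`, the dual of the tangent space. -/
abbrev Cotangent (E : Type*) [NormedAddCommGroup E] [NormedSpace ℝ E]
    {M : Type*} [TopologicalSpace M] [ChartedSpace E M] (x : M) : Type _ :=
  Module.Dual ℝ (TangentSpace 𝓘(ℝ, E) x)

/-- The differential at `x` of a real-valued function `f`, as a covector. -/
def differential (E : Type*) [NormedAddCommGroup E] [NormedSpace ℝ E]
    {M : Type*} [TopologicalSpace M] [ChartedSpace E M] (f : M → ℝ) (x : M) : Cotangent E x :=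
  (mvfderiv 𝓘(ℝ, E) f x).toLinearMap

/-- `f` is a smooth function near `x`. -/
abbrev SmoothAt (E : Type*) [NormedAddCommGroup E] [NormedSpace ℝ E]
    {M : Type*} [TopologicalSpace M] [ChartedSpace E M] (f : M → ℝ) (x : M) : Prop :=
  ContMDiffAt 𝓘(ℝ, E) 𝓘(ℝ, ℝ) ∞ f x

/-! ### Ad-invariant elements of `S² 𝔤` -/

/-- An ad-invariant element `s ∈ S² 𝔤`, regarded as a symmetric bilinear form on `𝔤*`. -/
structure InvariantSymmTensor (𝔤 : Type*) [LieRing 𝔤] [LieAlgebra ℝ 𝔤] where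
  form : LinearMap.BilinForm ℝ (Module.Dual ℝ 𝔤)
  symm : ∀ α β, form α β = form β α
  /-- Invariance under the coadjoint action `ξ • α = - α ∘ ad ξ`. -/
  ad_invariant : ∀ (ξ : 𝔤) (α β : Module.Dual ℝ 𝔤),
    form (α ∘ₗ (LieAlgebra.ad ℝ 𝔤 ξ : 𝔤 →ₗ[ℝ] 𝔤)) β
      + form α (β ∘ₗ (LieAlgebra.ad ℝ 𝔤 ξ : 𝔤 →ₗ[ℝ] 𝔤)) = 0

namespace InvariantSymmTensor

variable {𝔤 : Type*} [LieRing 𝔤] [LieAlgebra ℝ 𝔤] [FiniteDimensional ℝ 𝔤]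

/-- The map `s♯ : 𝔤* → 𝔤` with `β (s♯ α) = s (α, β)`. -/
def sharp (s : InvariantSymmTensor 𝔤) : Module.Dual ℝ 𝔤 →ₗ[ℝ] 𝔤 :=
  (Module.evalEquiv ℝ 𝔤).symm.toLinearMap ∘ₗ s.form

theorem apply_sharp (s : InvariantSymmTensor 𝔤) (α β : Module.Dual ℝ 𝔤) :
    β (s.sharp α) = s.form α β := by
  simp [sharp]

/-- The element `φ ∈ ∧³ 𝔤`, `φ(α, β, γ) = ½ α([s♯ β, s♯ γ])`. -/
def cubic (s : InvariantSymmTensor 𝔤) (α β γ : Module.Dual ℝ 𝔤) : ℝ :=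
  (1 / 2 : ℝ) * α ⁅s.sharp β, s.sharp γ⁆

end InvariantSymmTensor

/-! ### Actions, bivector fields, Schouten brackets -/

/-- A `𝔤`-manifold structure on `M`: a Lie algebra morphism from `𝔤` to the smooth vector fields on
`M` (equivalently, the anchor map of the action Lie algebroid). -/
structure Action (𝔤 : Type*) [LieRing 𝔤] [LieAlgebra ℝ 𝔤]
    (E : Type*) [NormedAddCommGroup E] [NormedSpace ℝ E]
    (M : Type*) [TopologicalSpace M] [ChartedSpace E M] [IsManifold 𝓘(ℝ, E) ∞ M] where
  anchor : ∀ x : M, 𝔤 →ₗ[ℝ] TangentSpace 𝓘(ℝ, E) x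
  smooth : ∀ ξ : 𝔤, ContMDiff 𝓘(ℝ, E) 𝓘(ℝ, E).tangent ∞
    (fun x : M => (⟨x, anchor x ξ⟩ : TangentBundle 𝓘(ℝ, E) M))
  map_lie : ∀ (ξ η : 𝔤) (x : M), anchor x ⁅ξ, η⁆ =
    VectorField.mlieBracket 𝓘(ℝ, E) (fun y => anchor y ξ) (fun y => anchor y η) x

/-- A smooth bivector field `π ∈ Γ(∧² TM)`: an alternating bilinear form on every cotangent space,
such that `π(df, dg)` is smooth whenever `f` and `g` are. -/
structure BivectorField (E : Type*) [NormedAddCommGroup E] [NormedSpace ℝ E]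
    (M : Type*) [TopologicalSpace M] [ChartedSpace E M] [IsManifold 𝓘(ℝ, E) ∞ M] where
  form : ∀ x : M, LinearMap.BilinForm ℝ (Cotangent E x)
  alt : ∀ (x : M) (α : Cotangent E x), form x α α = 0
  smooth : ∀ (x : M) (f g : M → ℝ), SmoothAt E f x → SmoothAt E g x →
    SmoothAt E (fun y => form y (differential E f y) (differential E g y)) x

section

variable {𝔤 : Type*} [LieRing 𝔤] [LieAlgebra ℝ 𝔤]
  {E : Type*} [NormedAddCommGroup E] [NormedSpace ℝ E]
  {M : Type*} [TopologicalSpace M] [ChartedSpace E M] [IsManifold 𝓘(ℝ, E) ∞ M]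

/-- The transpose `ρ*_x : T*_x M → 𝔤*` of the anchor. -/
def Action.transpose (ρ : Action 𝔤 E M) (x : M) : Cotangent E x →ₗ[ℝ] Module.Dual ℝ 𝔤 :=
  (ρ.anchor x).dualMap

/-- The map `π♯_x : T*_x M → T_x M` with `β (π♯ α) = π(α, β)`. -/
def BivectorField.sharp [FiniteDimensional ℝ E] (π : BivectorField E M) (x : M) :
    Cotangent E x →ₗ[ℝ] TangentSpace 𝓘(ℝ, E) x :=
  (Module.evalEquiv ℝ (TangentSpace 𝓘(ℝ, E) x)).symm.toLinearMap ∘ₗ π.form x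

theorem BivectorField.apply_sharp [FiniteDimensional ℝ E] (π : BivectorField E M) (x : M)
    (α β : Cotangent E x) : β (π.sharp x α) = π.form x α β := by
  simp [BivectorField.sharp]

/-- The function `{f, g} = π(df, dg)`. -/
def BivectorField.pairing (π : BivectorField E M) (f g : M → ℝ) : M → ℝ :=
  fun y => π.form y (differential E f y) (differential E g y)

/-- The value `[P, Q](df, dg, dh)` at `x` of the Schouten bracket of two bivector fields:
a multivector field is determined by its values on differentials of (locally defined) functions,
and on them the Schouten bracket is the graded commutator of multiderivations. It is normalized so
that `[X₁ ∧ X₂, Y₁ ∧ Y₂] = ∑ (-1)^(i+j) [Xᵢ, Yⱼ] ∧ X_{i'} ∧ Y_{j'}`, where multivectors are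
evaluated on covectors by determinants; for `P = Q` it is twice the Jacobiator
`{f, {g, h}} + {g, {h, f}} + {h, {f, g}}`. -/
def schoutenBivector (P Q : BivectorField E M) (f g h : M → ℝ) (x : M) : ℝ :=
  (P.pairing f (Q.pairing g h) x + P.pairing g (Q.pairing h f) x + P.pairing h (Q.pairing f g) x)
  + (Q.pairing f (P.pairing g h) x + Q.pairing g (P.pairing h f) x + Q.pairing h (P.pairing f g) x)

/-- The value `[P, X](df, dg)` at `x` of the Schouten bracket of a bivector field with a vector
field; it is minus the Lie derivative,
`(L_X P)(df, dg) = X (P(df, dg)) - P(d(X f), dg) - P(df, d(X g))`. -/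
def schoutenVector (P : BivectorField E M) (X : ∀ x : M, TangentSpace 𝓘(ℝ, E) x)
    (f g : M → ℝ) (x : M) : ℝ :=
  -(differential E (P.pairing f g) x (X x)
    - P.pairing (fun y => differential E f y (X y)) g x
    - P.pairing f (fun y => differential E g y (X y)) x)

/-! ### Quasi-Poisson manifolds -/

variable [FiniteDimensional ℝ 𝔤]

/-- `(M, ρ, π)` is a quasi-Poisson `𝔤`-manifold: `[π, π] = ρ(φ)`, and `[π, ρ(ξ)] = 0` for all
`ξ ∈ 𝔤`, i.e. `π` is `𝔤`-invariant. The trivector `ρ(φ)` has the values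
`ρ(φ)(α, β, γ) = φ(ρ* α, ρ* β, ρ* γ)`. -/
structure IsQuasiPoisson (s : InvariantSymmTensor 𝔤) (ρ : Action 𝔤 E M)
    (π : BivectorField E M) : Prop where
  bracket_self : ∀ (x : M) (f g h : M → ℝ), SmoothAt E f x → SmoothAt E g x → SmoothAt E h x →
    schoutenBivector π π f g h x =
      s.cubic (ρ.transpose x (differential E f x)) (ρ.transpose x (differential E g x))
        (ρ.transpose x (differential E h x))
  bracket_anchor : ∀ (ξ : 𝔤) (x : M) (f g : M → ℝ), SmoothAt E f x → SmoothAt E g x →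
    schoutenVector π (fun y => ρ.anchor y ξ) f g x = 0

variable [FiniteDimensional ℝ E]

/-- The anchor `a = π♯ + ½ ρ ∘ ρ* : T*M → TM` of the cotangent Lie algebroid, where `𝔤*` is
identified with `𝔤` through `s♯`. -/
def cotangentAnchor (s : InvariantSymmTensor 𝔤) (ρ : Action 𝔤 E M) (π : BivectorField E M) (x : M) :
    Cotangent E x →ₗ[ℝ] TangentSpace 𝓘(ℝ, E) x :=
  π.sharp x + (1 / 2 : ℝ) • (ρ.anchor x ∘ₗ s.sharp ∘ₗ ρ.transpose x)

/-- A quasi-symplectic `𝔤`-manifold: a quasi-Poisson `𝔤`-manifold with bijective anchor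
`a : T*M → TM`. -/
structure IsQuasiSymplectic (s : InvariantSymmTensor 𝔤) (ρ : Action 𝔤 E M)
    (π : BivectorField E M) : Prop where
  quasiPoisson : IsQuasiPoisson s ρ π
  bijective : ∀ x : M, Function.Bijective (cotangentAnchor s ρ π x)

end

/-! ### Moment maps -/

section

variable {F : Type*} [NormedAddCommGroup F] [NormedSpace ℝ F]
  {G : Type*} [TopologicalSpace G] [ChartedSpace F G] [Group G]

/-- The right-invariant vector field `ξ^R` with value `ξ` at the identity. (The left-invariant one,
`ξ^L`, is Mathlib's `mulInvariantVectorField ξ`.) -/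
def rightInvariantVectorField (ξ : GroupLieAlgebra 𝓘(ℝ, F) G) (g : G) :
    TangentSpace 𝓘(ℝ, F) g :=
  mfderiv 𝓘(ℝ, F) 𝓘(ℝ, F) (fun a : G => a * g) (1 : G) ξ

/-- The map `b_g : 𝔤 → T_g G`, `b_g(ξ) = ½ (ξ^L(g) + ξ^R(g))`. -/
def averagedTranslation (F : Type*) [NormedAddCommGroup F] [NormedSpace ℝ F]
    {G : Type*} [TopologicalSpace G] [ChartedSpace F G] [Group G] (g : G) :
    GroupLieAlgebra 𝓘(ℝ, F) G →ₗ[ℝ] TangentSpace 𝓘(ℝ, F) g where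
  toFun ξ := (1 / 2 : ℝ) •
    ((mulInvariantVectorField ξ g : TangentSpace 𝓘(ℝ, F) g) + rightInvariantVectorField ξ g)
  map_add' ξ η := by
    have h1 := congrFun (mulInvariantVectorField_add ξ η) g
    have h2 : rightInvariantVectorField (ξ + η) g
        = rightInvariantVectorField ξ g + rightInvariantVectorField η g :=
      (mfderiv 𝓘(ℝ, F) 𝓘(ℝ, F) (fun a : G => a * g) (1 : G)).map_add ξ η
    rw [h1, h2, Pi.add_apply, ← smul_add]
    congr 1
    abel
  map_smul' c ξ := by
    have h1 := congrFun (mulInvariantVectorField_smul c ξ) g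
    have h2 : rightInvariantVectorField (c • ξ) g = c • rightInvariantVectorField ξ g :=
      (mfderiv 𝓘(ℝ, F) 𝓘(ℝ, F) (fun a : G => a * g) (1 : G)).map_smul c ξ
    rw [h1, h2, Pi.smul_apply, ← smul_add, smul_comm, RingHom.id_apply]

variable [LieGroup 𝓘(ℝ, F) ∞ G] [FiniteDimensional ℝ F]
  {E : Type*} [NormedAddCommGroup E] [NormedSpace ℝ E] [FiniteDimensional ℝ E]
  {M : Type*} [TopologicalSpace M] [ChartedSpace E M] [IsManifold 𝓘(ℝ, E) ∞ M]

instance instCompleteSpaceModel {F : Type*} [NormedAddCommGroup F] [NormedSpace ℝ F]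
    [FiniteDimensional ℝ F] : CompleteSpace F := FiniteDimensional.complete ℝ F

/-- `Φ : M → G` is a moment map for `(M, ρ, π)`. -/
structure IsMomentMap (s : InvariantSymmTensor (GroupLieAlgebra 𝓘(ℝ, F) G))
    (ρ : Action (GroupLieAlgebra 𝓘(ℝ, F) G) E M) (π : BivectorField E M) (Φ : M → G) : Prop where
  smooth : ContMDiff 𝓘(ℝ, E) 𝓘(ℝ, F) ∞ Φ
  /-- `Φ` is equivariant for the conjugation action of `𝔤` on `G`, whose vector fields are
  `ξ^L - ξ^R`. -/
  equivariant : ∀ (ξ : GroupLieAlgebra 𝓘(ℝ, F) G) (x : M),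
    mfderiv 𝓘(ℝ, E) 𝓘(ℝ, F) Φ x (ρ.anchor x ξ) =
      mulInvariantVectorField ξ (Φ x) - rightInvariantVectorField ξ (Φ x)
  /-- `π♯(Φ* α) = ρ(Φ*(b* α))` for one-forms `α` on `G`; both sides are tensorial in `α`, so this
  is a condition on covectors. The section `b* α` of `𝔤*` is viewed in `𝔤` through `s♯`. -/
  moment : ∀ (x : M) (α : Cotangent F (Φ x)),
    π.sharp x (α ∘ₗ (mfderiv 𝓘(ℝ, E) 𝓘(ℝ, F) Φ x).toLinearMap) =
      ρ.anchor x (s.sharp (α ∘ₗ averagedTranslation F (Φ x)))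

/-- A Hamiltonian quasi-Poisson `𝔤`-manifold `(M, ρ, π, Φ)`. -/
structure IsHamiltonianQuasiPoisson (s : InvariantSymmTensor (GroupLieAlgebra 𝓘(ℝ, F) G))
    (ρ : Action (GroupLieAlgebra 𝓘(ℝ, F) G) E M) (π : BivectorField E M) (Φ : M → G) : Prop where
  quasiPoisson : IsQuasiPoisson s ρ π
  momentMap : IsMomentMap s ρ π Φ

/-- A quasi-Hamiltonian `𝔤`-manifold: a Hamiltonian quasi-Poisson `𝔤`-manifold with
`ρ_x(𝔤) + π♯_x(T*_x M) = T_x M` for every `x`. -/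
structure IsQuasiHamiltonian (s : InvariantSymmTensor (GroupLieAlgebra 𝓘(ℝ, F) G))
    (ρ : Action (GroupLieAlgebra 𝓘(ℝ, F) G) E M) (π : BivectorField E M) (Φ : M → G) : Prop where
  hamiltonian : IsHamiltonianQuasiPoisson s ρ π Φ
  nondegenerate : ∀ x : M,
    LinearMap.range (ρ.anchor x) ⊔ LinearMap.range (π.sharp x) = ⊤

/-- A Hamiltonian quasi-symplectic `𝔤`-manifold: a quasi-symplectic `𝔤`-manifold with a moment
map. -/
structure IsHamiltonianQuasiSymplectic (s : InvariantSymmTensor (GroupLieAlgebra 𝓘(ℝ, F) G))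
    (ρ : Action (GroupLieAlgebra 𝓘(ℝ, F) G) E M) (π : BivectorField E M) (Φ : M → G) : Prop where
  quasiSymplectic : IsQuasiSymplectic s ρ π
  momentMap : IsMomentMap s ρ π Φ

end

end QuasiPoisson

end

namespace QuasiPoisson

/-! The maps `π♯` and `a` differ by `½ ρ ∘ s♯ ∘ ρ*`, whose values lie in the image of `ρ`, so the
equality of ranges reduces to `im ρ ⊆ im a`. This inclusion comes from the moment map. On a
pulled-back covector `Φ*α`, the moment condition contributes `½ α(ξ^L + ξ^R)` to the argument of `ρ
∘ s♯`, and equivariance contributes `½ α(ξ^L - ξ^R)`. The right-invariant parts cancel, leaving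
`a(Φ*α) = ρ(s♯(α ∘ L))` with `L` the left translation (`IsMomentMap.cotangentAnchor_pullback`).
Since `L` is injective and `s` non-degenerate, `s♯(α ∘ L)` runs over all of `𝔤`. The equivalence
follows because `T*_x M` and `T_x M` have the same dimension, so `a` is bijective as soon as it is
onto. -/

theorem InvariantSymmTensor.sharp_surjective {𝔤 : Type*} [LieRing 𝔤] [LieAlgebra ℝ 𝔤]
    [FiniteDimensional ℝ 𝔤] (s : InvariantSymmTensor 𝔤) (hs : s.form.Nondegenerate) :
    Function.Surjective s.sharp := by
  have hinj : Function.Injective s.sharp := by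
    refine (injective_iff_map_eq_zero _).2 fun α hα => hs.1 α fun β => ?_
    rw [← s.apply_sharp, hα, map_zero]
  exact (LinearMap.injective_iff_surjective_of_finrank_eq_finrank
    Subspace.dual_finrank_eq).1 hinj

section

variable {F : Type*} [NormedAddCommGroup F] [NormedSpace ℝ F]
  {G : Type*} [TopologicalSpace G] [ChartedSpace F G] [Group G]

/-- Left translation `𝔤 → T_g G`, `ξ ↦ ξ^L(g)`, as a linear map. -/
noncomputable def leftTranslation (F : Type*) [NormedAddCommGroup F] [NormedSpace ℝ F]
    {G : Type*} [TopologicalSpace G] [ChartedSpace F G] [Group G] (g : G) :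
    GroupLieAlgebra 𝓘(ℝ, F) G →ₗ[ℝ] TangentSpace 𝓘(ℝ, F) g where
  toFun ξ := mulInvariantVectorField ξ g
  map_add' ξ η := congrFun (mulInvariantVectorField_add ξ η) g
  map_smul' c ξ := congrFun (mulInvariantVectorField_smul c ξ) g

/-- The differential of multiplication by `g⁻¹` is a left inverse, by the chain rule. -/
theorem leftTranslation_injective [LieGroup 𝓘(ℝ, F) ∞ G] (g : G) :
    Function.Injective (leftTranslation F g) := by
  have hd (a b : G) : MDifferentiableAt 𝓘(ℝ, F) 𝓘(ℝ, F) (fun c : G => a * c) b :=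
    (contMDiff_mul_left (I := 𝓘(ℝ, F)) (n := ∞) (a := a)).mdifferentiableAt (by simp)
  -- The base point is kept as `g * 1`, the image of `1` under translation, to match the chain rule.
  have hcomp : (mfderiv 𝓘(ℝ, F) 𝓘(ℝ, F) (fun c : G => g⁻¹ * c) (g * 1)).comp
      (mfderiv 𝓘(ℝ, F) 𝓘(ℝ, F) (fun c : G => g * c) (1 : G)) =
      mfderiv 𝓘(ℝ, F) 𝓘(ℝ, F) (fun c : G => c) (1 : G) := by
    rw [← mfderiv_comp (1 : G) (hd g⁻¹ (g * 1)) (hd g 1)]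
    congr 1
    ext c
    simp
  refine (injective_iff_map_eq_zero _).2 fun ξ hξ => ?_
  have hξ' : mfderiv 𝓘(ℝ, F) 𝓘(ℝ, F) (fun c : G => g * c) (1 : G) ξ = 0 := hξ
  have h := DFunLike.congr_fun hcomp ξ
  rw [show (fun c : G => c) = id from rfl, mfderiv_id] at h
  refine h.symm.trans ?_
  erw [ContinuousLinearMap.comp_apply, hξ', map_zero]
  rfl

variable [LieGroup 𝓘(ℝ, F) ∞ G] [FiniteDimensional ℝ F]
  {E : Type*} [NormedAddCommGroup E] [NormedSpace ℝ E] [FiniteDimensional ℝ E]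
  {M : Type*} [TopologicalSpace M] [ChartedSpace E M] [IsManifold 𝓘(ℝ, E) ∞ M]
  {s : InvariantSymmTensor (GroupLieAlgebra 𝓘(ℝ, F) G)}
  {ρ : Action (GroupLieAlgebra 𝓘(ℝ, F) G) E M} {π : BivectorField E M} {Φ : M → G}

/-- The cotangent anchor intertwines the pullback of covectors along `Φ` with left translation:
`a(Φ* α) = ρ(s♯(α ∘ ξ^L))`. -/
theorem IsMomentMap.cotangentAnchor_pullback (h : IsMomentMap s ρ π Φ) (x : M)
    (α : Cotangent F (Φ x)) :
    cotangentAnchor s ρ π x (α ∘ₗ (mfderiv 𝓘(ℝ, E) 𝓘(ℝ, F) Φ x).toLinearMap) =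
      ρ.anchor x (s.sharp (α ∘ₗ leftTranslation F (Φ x))) := by
  -- By equivariance this is `½(ξ^L + ξ^R) + ½(ξ^L - ξ^R) = ξ^L`, tested against `α`.
  have hcov : α ∘ₗ averagedTranslation F (Φ x) + (1 / 2 : ℝ) •
      ρ.transpose x (α ∘ₗ (mfderiv 𝓘(ℝ, E) 𝓘(ℝ, F) Φ x).toLinearMap) =
      α ∘ₗ leftTranslation F (Φ x) := by
    ext ξ
    have hL : leftTranslation F (Φ x) ξ = mulInvariantVectorField ξ (Φ x) := rfl
    have hA : averagedTranslation F (Φ x) ξ = (1 / 2 : ℝ) •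
      ((mulInvariantVectorField ξ (Φ x) : TangentSpace 𝓘(ℝ, F) (Φ x)) +
        rightInvariantVectorField ξ (Φ x)) := rfl
    have hT : ρ.transpose x (α ∘ₗ (mfderiv 𝓘(ℝ, E) 𝓘(ℝ, F) Φ x).toLinearMap) ξ =
      α (mfderiv 𝓘(ℝ, E) 𝓘(ℝ, F) Φ x (ρ.anchor x ξ)) := rfl
    rw [LinearMap.add_apply, LinearMap.smul_apply, hT, h.equivariant, LinearMap.comp_apply,
      LinearMap.comp_apply, hL, hA, map_smul, map_add, map_sub, smul_eq_mul, smul_eq_mul]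
    ring
  rw [← hcov, map_add, map_add, map_smul, map_smul, ← h.moment]
  rfl

/-- Covectors pulled back along `Φ` already suffice: every `ξ` is `s♯ β`, and every `β` is `α ∘ L`,
because the transpose of an injective map is onto. -/
theorem IsMomentMap.range_anchor_le (hs : s.form.Nondegenerate) (h : IsMomentMap s ρ π Φ) (x : M) :
    LinearMap.range (ρ.anchor x) ≤ LinearMap.range (cotangentAnchor s ρ π x) := by
  rintro _ ⟨ξ, rfl⟩
  obtain ⟨β, rfl⟩ := s.sharp_surjective hs ξ
  obtain ⟨α, rfl⟩ :=
    LinearMap.dualMap_surjective_of_injective (leftTranslation_injective (F := F) (Φ x)) β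
  exact ⟨_, h.cotangentAnchor_pullback x α⟩

/-- Modulo the image of `ρ`, the maps `π♯` and `a` coincide. -/
theorem IsMomentMap.range_cotangentAnchor (hs : s.form.Nondegenerate) (h : IsMomentMap s ρ π Φ)
    (x : M) :
    LinearMap.range (ρ.anchor x) ⊔ LinearMap.range (π.sharp x) =
      LinearMap.range (cotangentAnchor s ρ π x) := by
  refine le_antisymm (sup_le (h.range_anchor_le hs x) ?_) ?_
  · rintro _ ⟨α, rfl⟩
    have hα : π.sharp x α = cotangentAnchor s ρ π x α -
        (1 / 2 : ℝ) • ρ.anchor x (s.sharp (ρ.transpose x α)) :=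
      (add_sub_cancel_right _ _).symm
    rw [hα]
    exact Submodule.sub_mem _ ⟨α, rfl⟩
      (Submodule.smul_mem _ _ (h.range_anchor_le hs x ⟨_, rfl⟩))
  · rintro _ ⟨α, rfl⟩
    exact Submodule.add_mem _ (Submodule.mem_sup_right ⟨α, rfl⟩)
      (Submodule.smul_mem _ _ (Submodule.mem_sup_left ⟨_, rfl⟩))

/-- A surjective linear map between spaces of equal finite dimension is injective. -/
theorem cotangentAnchor_bijective_iff (s : InvariantSymmTensor (GroupLieAlgebra 𝓘(ℝ, F) G))
    (ρ : Action (GroupLieAlgebra 𝓘(ℝ, F) G) E M) (π : BivectorField E M) (x : M) :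
    Function.Bijective (cotangentAnchor s ρ π x) ↔
      LinearMap.range (cotangentAnchor s ρ π x) = ⊤ := by
  rw [LinearMap.range_eq_top]
  exact ⟨fun h => h.2, fun h => ⟨(LinearMap.injective_iff_surjective_of_finrank_eq_finrank
    Subspace.dual_finrank_eq).2 h, h⟩⟩

end

end QuasiPoisson

theorem theorem1p10
    {F : Type*} [NormedAddCommGroup F] [NormedSpace ℝ F] [FiniteDimensional ℝ F]
    {G : Type*} [TopologicalSpace G] [ChartedSpace F G] [Group G] [LieGroup 𝓘(ℝ, F) ∞ G]
    {E : Type*} [NormedAddCommGroup E] [NormedSpace ℝ E] [FiniteDimensional ℝ E]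
    {M : Type*} [TopologicalSpace M] [ChartedSpace E M] [IsManifold 𝓘(ℝ, E) ∞ M]
    (s : QuasiPoisson.InvariantSymmTensor (GroupLieAlgebra 𝓘(ℝ, F) G))
    (hs : s.form.Nondegenerate)
    (ρ : QuasiPoisson.Action (GroupLieAlgebra 𝓘(ℝ, F) G) E M)
    (π : QuasiPoisson.BivectorField E M) (Φ : M → G) :
    (QuasiPoisson.IsHamiltonianQuasiPoisson s ρ π Φ →
      ∀ x : M, LinearMap.range (ρ.anchor x) ⊔ LinearMap.range (π.sharp x) =
        LinearMap.range (QuasiPoisson.cotangentAnchor s ρ π x)) ∧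
    (QuasiPoisson.IsQuasiHamiltonian s ρ π Φ ↔
      QuasiPoisson.IsHamiltonianQuasiSymplectic s ρ π Φ) := by
  refine ⟨fun h => h.momentMap.range_cotangentAnchor hs, fun h => ?_, fun h => ?_⟩
  · refine ⟨⟨h.hamiltonian.quasiPoisson, fun x => ?_⟩, h.hamiltonian.momentMap⟩
    rw [QuasiPoisson.cotangentAnchor_bijective_iff,
      ← h.hamiltonian.momentMap.range_cotangentAnchor hs]
    exact h.nondegenerate x
  · refine ⟨⟨h.quasiSymplectic.quasiPoisson, h.momentMap⟩, fun x => ?_⟩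
    rw [h.momentMap.range_cotangentAnchor hs, ← QuasiPoisson.cotangentAnchor_bijective_iff]
    exact h.quasiSymplectic.bijective x
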